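/- Let $K=\langle S_K\mid R_K\rangle$ be a finitely generated right-angled Artin group in its standard presentation: $S_K$ is the vertex set of a finite simplicial graph and $R_K$ consists of the commutators $[v,w]=vwv^{-1}w^{-1}$ of adjacent vertices. Let $n\ge 0$, and for $i=1,\dots,n$ let $A_i,B_i\subseteq S_K$ be subsets and $f_i:A_i\to B_i$ a bijection. Suppose that each $f_i$ extends to an automorphism $\bar f_i$ of $K$ which is induced by a permutation $\sigma_i$ of $S_K$ (so $\bar f_i(v)=\sigma_i(v)$ for $v\in S_K$ and $\bar f_i(a)=f_i(a)$ for $a\in A_i$; in particular $f_i$ extends to an isomorphism $\langle A_i\rangle\to\langle B_i\rangle$ between subgroups of $K$), and that the generators occurring in any one cycle of $\sigma_i$ generate a free abelian subgroup of $K$. Suppose that $\bar f_1,\dots,\bar f_n$ generate a finite subgroup $D$ of $\mathrm{Aut}(K)$. Then the multiple HNN-extension $$G=\langle S_K,t_1,\dots,t_n\mid R_K,\ t_i a t_i^{-1}=f_i(a)\ (1\le i\le n,\ a\in A_i)\rangle$$ is $\mathbb{Z}$-linear, i.e. there are $d\in\mathbb{N}$ and an injective homomorphism $G\to GL_d(\mathbb{Z})$.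 -/

import Mathlib

/-- Defining relators of the right-angled Artin group of `Γ`: one commutator
`[v, w] = v * w * v⁻¹ * w⁻¹` for every edge `{v, w}`. -/
def RAAG.rels {V : Type*} (Γ : SimpleGraph V) : Set (FreeGroup V) :=
  {r | ∃ v w : V, Γ.Adj v w ∧
    r = FreeGroup.of v * FreeGroup.of w * (FreeGroup.of v)⁻¹ * (FreeGroup.of w)⁻¹}

/-- The right-angled Artin group of the graph `Γ`, given by its standard presentation
`⟨V | [v, w] = 1 for every edge {v, w}⟩`. -/
abbrev RAAG {V : Type*} (Γ : SimpleGraph V) : Type _ :=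
  PresentedGroup (RAAG.rels Γ)

/-- The standard generator of the right-angled Artin group attached to a vertex. -/
def RAAG.gen {V : Type*} (Γ : SimpleGraph V) (v : V) : RAAG Γ :=
  PresentedGroup.of v

/-- `G` is a free abelian group. -/
def IsFreeAbelian.{u} (G : Type u) [Group G] : Prop :=
  ∃ ι : Type u, Nonempty (G ≃* Multiplicative (FreeAbelianGroup ι))

/-- `G` is linear over `ℤ`: it has a faithful representation in `GL_d(ℤ)` for some `d`. -/
def IsZLinear (G : Type*) [Group G] : Prop :=
  ∃ (d : ℕ) (ρ : G →* Matrix.GeneralLinearGroup (Fin d) ℤ), Function.Injective ρ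

/-- Relators of the multiple HNN-extension of the right-angled Artin group of `Γ` with stable
letters `t i`. The generators are the vertices `Sum.inl v` and the stable letters `t i = Sum.inr i`;
the relators are those of the right-angled Artin group, and `t i * a * (t i)⁻¹ * (f i a)⁻¹` for
every `i` and every `a ∈ A i`. -/
def MultipleHNN.rels {V : Type*} (Γ : SimpleGraph V) {n : ℕ} (A B : Fin n → Set V)
    (f : ∀ i, A i ≃ B i) : Set (FreeGroup (V ⊕ Fin n)) :=
  {r | ∃ v w : V, Γ.Adj v w ∧
      r = FreeGroup.of (Sum.inl v) * FreeGroup.of (Sum.inl w) *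
        (FreeGroup.of (Sum.inl v))⁻¹ * (FreeGroup.of (Sum.inl w))⁻¹} ∪
  {r | ∃ (i : Fin n) (a : A i),
      r = FreeGroup.of (Sum.inr i) * FreeGroup.of (Sum.inl (a : V)) *
        (FreeGroup.of (Sum.inr i))⁻¹ * (FreeGroup.of (Sum.inl (f i a : V)))⁻¹}

/-- The multiple HNN-extension
`⟨V, t 1, …, t n | [v, w] = 1 for every edge {v, w}, t i * a * (t i)⁻¹ = f i a for a ∈ A i⟩`;
there are no relators between the stable letters. -/
abbrev MultipleHNN {V : Type*} (Γ : SimpleGraph V) {n : ℕ} (A B : Fin n → Set V)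
    (f : ∀ i, A i ≃ B i) : Type _ :=
  PresentedGroup (MultipleHNN.rels Γ A B f)

universe u

/-! ### Right-angled Artin groups and their graph automorphisms -/

namespace RAAG

variable {V : Type*} (Γ : SimpleGraph V)

/-! The multiple HNN-extension `G` embeds in a larger right-angled Artin group extended by the
finite group `Aut Γ`, and such an extension is linear over `ℤ`.

Embedding. Distinct generators commute only if they are adjacent, so each `σ i` is a graph
automorphism `e i`. Since `t i` and `e i` agree on `A i` as conjugations, `t i` should be `e i`
times an element centralizing `B i`. Therefore `extGraph` adjoins free vertices `(i, d)` commuting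
with `d (B i)`, a family stable under `Aut Γ`, and `toExt` sends `t i` to `(i, 1) * e i`. For
injectivity (`toExt_injective`), `G` is amalgamated with `RAAG Γ ⋊ Aut Γ` over `RAAG Γ`; there `t i
* (e i)⁻¹` does centralize `B i`, so the extension maps to the amalgam compatibly with the embedding
of `G`.

Linearity. Each generator acts as a product of two reflections in the dual Tits representation of a
right-angled Coxeter group on `V × Bool`. Negative coordinates of a translate of the all-ones vector
reveal possible first letters of `g` (`rep_one_aux`), so only `1` fixes this vector. Graph
automorphisms permute coordinates and also fix it, hence the semidirect product acts faithfully
(`semidirectRep_injective`). -/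

lemma gen_commute {v w : V} (h : Γ.Adj v w) : Commute (gen Γ v) (gen Γ w) := by
  have h1 : gen Γ v * gen Γ w * (gen Γ v)⁻¹ * (gen Γ w)⁻¹ = 1 :=
    PresentedGroup.one_of_mem (rels := rels Γ) ⟨v, w, h, rfl⟩
  rw [mul_inv_eq_one, mul_inv_eq_iff_eq_mul] at h1
  exact h1

/-- The universal property of a right-angled Artin group. -/
def lift {H : Type*} [Group H] (F : V → H) (hF : ∀ v w, Γ.Adj v w → Commute (F v) (F w)) :
    RAAG Γ →* H :=
  PresentedGroup.toGroup (f := F) <| by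
    rintro r ⟨v, w, h, rfl⟩
    simp [(hF v w h).eq]

@[simp]
lemma lift_gen {H : Type*} [Group H] (F : V → H)
    (hF : ∀ v w, Γ.Adj v w → Commute (F v) (F w)) (v : V) :
    lift Γ F hF (gen Γ v) = F v :=
  PresentedGroup.toGroup.of _

variable {Γ} in
lemma hom_ext {H : Type*} [Group H] {φ ψ : RAAG Γ →* H}
    (h : ∀ v, φ (gen Γ v) = ψ (gen Γ v)) : φ = ψ :=
  PresentedGroup.ext h

lemma gen_injective : Function.Injective (gen Γ) := by
  classical
  intro v w h
  by_contra hne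
  have := congrArg (lift Γ (fun u => Multiplicative.ofAdd (if u = v then (1 : ℤ) else 0))
    fun _ _ _ => Commute.all _ _) h
  simp [Ne.symm hne] at this

/-- Non-adjacent `v` and `w` are separated by a map to the symmetric group on three points: they go
to non-commuting transpositions and all other generators to `1`. -/
lemma adj_of_commute {v w : V} (hne : v ≠ w) (h : Commute (gen Γ v) (gen Γ w)) :
    Γ.Adj v w := by
  classical
  by_contra hadj
  let F : V → Equiv.Perm (Fin 3) := fun u =>
    if u = v then Equiv.swap 0 1 else if u = w then Equiv.swap 1 2 else 1
  have hF : ∀ a b, Γ.Adj a b → Commute (F a) (F b) := by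
    intro a b hab
    by_cases ha : a = v
    · subst ha
      have hb : b ≠ a := hab.ne'
      have hb' : b ≠ w := fun e => hadj (e ▸ hab)
      simp [F, hb, hb']
    · by_cases ha' : a = w
      · subst ha'
        have hb : b ≠ a := hab.ne'
        have hb' : b ≠ v := fun e => hadj (e ▸ hab.symm)
        simp [F, hb, hb']
      · simp [F, ha, ha']
  have := h.map (lift Γ F hF)
  simp only [lift_gen, F, if_true, hne.symm, if_false] at this
  revert this
  simp only [Commute, SemiconjBy]
  decide

/-- The endomorphism of the right-angled Artin group induced by a graph automorphism. -/
def endOfIso (e : Γ ≃g Γ) : RAAG Γ →* RAAG Γ :=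
  lift Γ (fun v => gen Γ (e v)) fun _ _ h => gen_commute Γ (e.map_rel_iff.2 h)

@[simp]
lemma endOfIso_gen (e : Γ ≃g Γ) (v : V) : endOfIso Γ e (gen Γ v) = gen Γ (e v) :=
  lift_gen _ _ _ _

/-- The action of graph automorphisms on the right-angled Artin group. -/
def autHom : (Γ ≃g Γ) →* MulAut (RAAG Γ) where
  toFun e := MonoidHom.toMulEquiv (endOfIso Γ e) (endOfIso Γ e⁻¹)
    (hom_ext fun v => by simp) (hom_ext fun v => by simp)
  map_one' := MulEquiv.toMonoidHom_injective <| hom_ext fun v => by simp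
  map_mul' d e := MulEquiv.toMonoidHom_injective <| hom_ext fun v => by simp

@[simp]
lemma autHom_gen (e : Γ ≃g Γ) (v : V) : autHom Γ e (gen Γ v) = gen Γ (e v) :=
  endOfIso_gen Γ e v

/-! ### Word length -/

/-- The generator `v` or its inverse, according to the sign `b`. -/
def letter (p : V × Bool) : RAAG Γ := cond p.2 (gen Γ p.1) (gen Γ p.1)⁻¹

lemma letter_not_mul_letter (v : V) (b : Bool) :
    letter Γ (v, !b) * letter Γ (v, b) = 1 := by
  cases b <;> simp [letter]

lemma letter_commute {p q : V × Bool} (h : Γ.Adj p.1 q.1) :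
    Commute (letter Γ p) (letter Γ q) := by
  have := gen_commute Γ h
  rcases p with ⟨v, _ | _⟩ <;> rcases q with ⟨w, _ | _⟩ <;> simpa [letter] using this

lemma exists_prod_letter (g : RAAG Γ) :
    ∃ L : List (V × Bool), (L.map (letter Γ)).prod = g := by
  obtain ⟨x, rfl⟩ := PresentedGroup.mk_surjective _ g
  induction x using FreeGroup.induction_on with
  | C1 => exact ⟨[], by simp⟩
  | of v => exact ⟨[(v, true)], by simp [letter, gen, PresentedGroup.of]⟩
  | inv_of v _ => exact ⟨[(v, false)], by simp [letter, gen, PresentedGroup.of]⟩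
  | mul x y hx hy =>
    obtain ⟨L, hL⟩ := hx
    obtain ⟨M, hM⟩ := hy
    exact ⟨L ++ M, by simp [hL, hM]⟩

/-- The word length with respect to the standard generators. -/
noncomputable def length (g : RAAG Γ) : ℕ :=
  sInf {k | ∃ L : List (V × Bool), (L.map (letter Γ)).prod = g ∧ L.length = k}

lemma exists_prod_letter_length (g : RAAG Γ) :
    ∃ L : List (V × Bool), (L.map (letter Γ)).prod = g ∧ L.length = length Γ g :=
  Nat.sInf_mem (s := {k | ∃ L : List (V × Bool), (L.map (letter Γ)).prod = g ∧ L.length = k})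
    (let ⟨L, hL⟩ := exists_prod_letter Γ g; ⟨L.length, L, hL, rfl⟩)

lemma length_prod_le (L : List (V × Bool)) :
    length Γ (L.map (letter Γ)).prod ≤ L.length :=
  Nat.sInf_le ⟨L, rfl, rfl⟩

lemma length_letter_mul_le (p : V × Bool) (g : RAAG Γ) :
    length Γ (letter Γ p * g) ≤ length Γ g + 1 := by
  obtain ⟨L, hL, hl⟩ := exists_prod_letter_length Γ g
  simpa [hL, hl] using length_prod_le Γ (p :: L)

lemma exists_eq_letter_mul {g : RAAG Γ} (hg : g ≠ 1) :
    ∃ p h, g = letter Γ p * h ∧ length Γ h < length Γ g := by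
  obtain ⟨L, hL, hl⟩ := exists_prod_letter_length Γ g
  cases L with
  | nil => exact absurd hL.symm hg
  | cons p L =>
    refine ⟨p, (L.map (letter Γ)).prod, by simpa using hL.symm, ?_⟩
    rw [← hl]
    exact (length_prod_le Γ L).trans_lt (by simp)

/-! ### A faithful representation by products of reflections -/

section Reflection

open Classical in
/-- Entries of the reflection matrices; letters with adjacent vertices are orthogonal, any other
two distinct letters generate an infinite dihedral group. -/
noncomputable def coeff (p q : V × Bool) : ℤ :=
  if p = q then -2 else if Γ.Adj p.1 q.1 then 0 else 2

lemma coeff_self (p : V × Bool) : coeff Γ p p = -2 := by simp [coeff]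

lemma coeff_of_adj {p q : V × Bool} (h : Γ.Adj p.1 q.1) : coeff Γ p q = 0 := by
  have : p ≠ q := fun e => h.ne (e ▸ rfl)
  simp [coeff, this, h]

lemma coeff_of_not_adj {p q : V × Bool} (hne : p ≠ q) (h : ¬Γ.Adj p.1 q.1) :
    coeff Γ p q = 2 := by
  simp [coeff, hne, h]

/-- The reflection attached to a letter. -/
noncomputable def reflection (p : V × Bool) : (V × Bool → ℤ) ≃ₗ[ℤ] (V × Bool → ℤ) :=
  LinearEquiv.ofInvolutive
    { toFun := fun x q => x q + coeff Γ p q * x p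
      map_add' := fun x y => by ext q; simp; ring
      map_smul' := fun c x => by ext q; simp; ring }
    fun x => by ext q; simp [coeff_self]; ring

lemma reflection_apply (p : V × Bool) (x : V × Bool → ℤ) (q : V × Bool) :
    reflection Γ p x q = x q + coeff Γ p q * x p := rfl

lemma reflection_mul_self (p : V × Bool) : reflection Γ p * reflection Γ p = 1 := by
  ext1 x
  ext q
  simp [reflection_apply, coeff_self]
  ring

lemma reflection_commute {p q : V × Bool} (h : Γ.Adj p.1 q.1) :
    Commute (reflection Γ p) (reflection Γ q) := by
  ext1 x
  ext r
  simp [reflection_apply, coeff_of_adj Γ h, coeff_of_adj Γ h.symm]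
  ring

/-- The representation sending a generator to a product of two reflections. -/
noncomputable def rep : RAAG Γ →* ((V × Bool → ℤ) ≃ₗ[ℤ] (V × Bool → ℤ)) :=
  lift Γ (fun v => reflection Γ (v, true) * reflection Γ (v, false)) fun v w h =>
    ((reflection_commute Γ (p := (v, true)) (q := (w, true)) h).mul_left
      (reflection_commute Γ (p := (v, false)) (q := (w, true)) h)).mul_right
    ((reflection_commute Γ (p := (v, true)) (q := (w, false)) h).mul_left
      (reflection_commute Γ (p := (v, false)) (q := (w, false)) h))

lemma rep_letter (v : V) (b : Bool) :
    rep Γ (letter Γ (v, b)) = reflection Γ (v, b) * reflection Γ (v, !b) := by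
  cases b
  · simp only [letter, cond_false, map_inv, rep, lift_gen, Bool.not_false, mul_inv_rev]
    rw [← eq_inv_of_mul_eq_one_left (reflection_mul_self Γ (v, false)),
      ← eq_inv_of_mul_eq_one_left (reflection_mul_self Γ (v, true))]
  · simp [letter, rep]

/-- Any two coordinates of `x` at letters generating an infinite dihedral group have positive
sum. -/
def PairPositive (x : V × Bool → ℤ) : Prop :=
  ∀ p q, p ≠ q → ¬Γ.Adj p.1 q.1 → 0 < x p + x q

variable {Γ}

lemma PairPositive.reflection_pos {x : V × Bool → ℤ} (hx : PairPositive Γ x) {p q : V × Bool}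
    (hp : 0 < x p) (hne : p ≠ q) (h : ¬Γ.Adj p.1 q.1) : 0 < reflection Γ p x q := by
  rw [reflection_apply, coeff_of_not_adj Γ hne h]
  linarith [hx p q hne h]

lemma PairPositive.reflection {x : V × Bool → ℤ} (hx : PairPositive Γ x) {p : V × Bool}
    (hp : 0 < x p) : PairPositive Γ (reflection Γ p x) := by
  have key : ∀ q r, q ≠ r → ¬Γ.Adj q.1 r.1 → r ≠ p →
      0 < RAAG.reflection Γ p x q + RAAG.reflection Γ p x r := by
    intro q r hne hadj hr
    have h0 := hx q r hne hadj
    simp only [reflection_apply]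
    -- If `q = p`, the sum is unchanged: `x p + x r` becomes `-x p + (x r + 2 * x p)`. Otherwise
    -- neither coordinate decreases.
    by_cases hq : p = q
    · subst hq
      rw [coeff_self, coeff_of_not_adj Γ hne hadj]
      linarith
    · have hc : ∀ s, p ≠ s → 0 ≤ coeff Γ p s := by
        intro s hs
        simp only [coeff, hs, if_false]
        split_ifs <;> norm_num
      nlinarith [mul_nonneg (hc q hq) hp.le, mul_nonneg (hc r (Ne.symm hr)) hp.le]
  intro q r hne hadj
  by_cases hr : r = p
  · rw [add_comm]
    exact key r q hne.symm (fun h => hadj h.symm) (fun h => hne (h.trans hr.symm))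
  · exact key q r hne hadj hr

variable (Γ) in
/-- Coordinates of translates of the all-ones vector: a coordinate is negative only at a letter
which begins a shortest word. -/
lemma rep_one_aux (k : ℕ) : ∀ g : RAAG Γ, length Γ g = k →
    PairPositive Γ (rep Γ g 1) ∧ ∀ v b, rep Γ g 1 (v, b) ≤ 0 →
      rep Γ g 1 (v, b) < 0 ∧ length Γ (letter Γ (v, !b) * g) < length Γ g := by
  induction k using Nat.strong_induction_on with
  | _ k ih =>
  rintro g rfl
  by_cases hg : g = 1
  · subst hg
    refine ⟨fun p q _ _ => by simp, fun v b h => ?_⟩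
    simp at h
  obtain ⟨⟨v, b⟩, h, rfl, hlt⟩ := exists_eq_letter_mul Γ hg
  obtain ⟨hP, hneg⟩ := ih _ hlt h rfl
  set y := rep Γ h 1 with hy
  -- Otherwise the induction hypothesis would make `letter (v, b) * h` shorter than `h`, whereas it
  -- is longer.
  have hpos : 0 < y (v, !b) := by
    by_contra hcon
    have := (hneg v (!b) (not_lt.1 hcon)).2
    rw [Bool.not_not] at this
    omega
  have hne : (v, !b) ≠ (v, b) := by simp
  set z := reflection Γ (v, !b) y with hz
  have hzP : PairPositive Γ z := hP.reflection hpos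
  have hzpos : 0 < z (v, b) := hP.reflection_pos hpos hne (by simp)
  have hrep : rep Γ (letter Γ (v, b) * h) 1 = reflection Γ (v, b) z := by
    rw [map_mul, rep_letter]
    rfl
  rw [hrep]
  refine ⟨hzP.reflection hzpos, fun w c hwc => ?_⟩
  by_cases hw : (v, b) = (w, c)
  · obtain ⟨rfl, rfl⟩ := Prod.mk.inj hw
    refine ⟨by rw [reflection_apply, coeff_self]; linarith, ?_⟩
    rwa [← mul_assoc, letter_not_mul_letter, one_mul]
  by_cases hadj : Γ.Adj v w
  -- Orthogonal letters: both reflections leave this coordinate alone, and the letters commute, so a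
  -- shortening of `h` gives one of `letter (v, b) * h`.
  · have hyw : reflection Γ (v, b) z (w, c) = y (w, c) := by
      rw [reflection_apply, coeff_of_adj Γ (p := (v, b)) (q := (w, c)) hadj, hz,
        reflection_apply, coeff_of_adj Γ (p := (v, !b)) (q := (w, c)) hadj]
      ring
    rw [hyw] at hwc ⊢
    obtain ⟨h1, h2⟩ := hneg w c hwc
    refine ⟨h1, ?_⟩
    rw [← mul_assoc, (letter_commute Γ (p := (w, !c)) (q := (v, b)) hadj.symm).eq, mul_assoc]
    have := length_letter_mul_le Γ (v, b) (letter Γ (w, !c) * h)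
    omega
  · exact absurd (hzP.reflection_pos hzpos hw hadj) (not_lt.2 hwc)

/-- If `g` began with a letter, stripping it off would give a shorter `k` whose translate has
coordinate `-3` at the opposite letter; then `rep_one_aux` would make `g` shorter than `k`. -/
lemma eq_one_of_rep_one {g : RAAG Γ} (h : rep Γ g 1 = 1) : g = 1 := by
  by_contra hg
  obtain ⟨⟨v, b⟩, k, rfl, hlt⟩ := exists_eq_letter_mul Γ hg
  have hinv : k = letter Γ (v, !b) * (letter Γ (v, b) * k) := by
    rw [← mul_assoc, letter_not_mul_letter, one_mul]
  have hk : rep Γ k 1 = reflection Γ (v, !b) (reflection Γ (v, b) 1) := by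
    conv_lhs => rw [hinv, map_mul, rep_letter, Bool.not_not]
    rw [LinearEquiv.mul_apply, LinearEquiv.mul_apply, h]
  have hneg : rep Γ k 1 (v, !b) ≤ 0 := by
    have hne : (v, b) ≠ (v, !b) := by simp
    rw [hk, reflection_apply, coeff_self, reflection_apply,
      coeff_of_not_adj Γ hne (by simp)]
    simp
  have := (((rep_one_aux Γ _ k rfl).2 v (!b) hneg).2)
  rw [Bool.not_not] at this
  omega

end Reflection

/-! ### Faithfulness on the semidirect product with the graph automorphisms -/

/-- Graph automorphisms permute the coordinates. -/
def permRep : (Γ ≃g Γ) →* ((V × Bool → ℤ) ≃ₗ[ℤ] (V × Bool → ℤ)) where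
  toFun e := LinearEquiv.funCongrLeft ℤ ℤ (e⁻¹.toEquiv.prodCongr (Equiv.refl Bool))
  map_one' := rfl
  map_mul' _ _ := rfl

lemma permRep_apply (e : Γ ≃g Γ) (x : V × Bool → ℤ) (p : V × Bool) :
    permRep Γ e x p = x (e⁻¹ p.1, p.2) := rfl

lemma permRep_mul_reflection (e : Γ ≃g Γ) (v : V) (b : Bool) :
    permRep Γ e * reflection Γ (v, b) = reflection Γ (e v, b) * permRep Γ e := by
  ext1 x
  ext q
  have : coeff Γ (v, b) (e⁻¹ q.1, q.2) = coeff Γ (e v, b) q := by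
    obtain ⟨q, c⟩ := q
    obtain ⟨w, rfl⟩ := e.surjective q
    rw [RelIso.inv_apply_self]
    by_cases h1 : (v, b) = (w, c)
    · obtain ⟨rfl, rfl⟩ := Prod.mk.inj h1
      rw [coeff_self, coeff_self]
    · have h2 : (e v, b) ≠ (e w, c) := fun h => h1 (by simpa using h)
      by_cases hadj : Γ.Adj v w
      · rw [coeff_of_adj Γ (p := (v, b)) (q := (w, c)) hadj,
          coeff_of_adj Γ (p := (e v, b)) (q := (e w, c)) (e.map_adj_iff.2 hadj)]
      · rw [coeff_of_not_adj Γ h1 hadj,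
          coeff_of_not_adj Γ h2 fun h => hadj (e.map_adj_iff.1 h)]
  simp [permRep_apply, reflection_apply, this]

/-- The representation of `RAAG Γ ⋊ Aut Γ` on `ℤ ^ (V × Bool)`. -/
noncomputable def semidirectRep :
    RAAG Γ ⋊[autHom Γ] (Γ ≃g Γ) →* ((V × Bool → ℤ) ≃ₗ[ℤ] (V × Bool → ℤ)) :=
  SemidirectProduct.lift (rep Γ) (permRep Γ) fun e => hom_ext fun v => by
    simp only [MonoidHom.comp_apply, MulEquiv.coe_toMonoidHom, autHom_gen, MulAut.conj_apply,
      rep, lift_gen]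
    rw [eq_mul_inv_iff_mul_eq, ← mul_assoc, permRep_mul_reflection, mul_assoc, mul_assoc,
      permRep_mul_reflection]

lemma semidirectRep_injective : Function.Injective (semidirectRep Γ) := by
  rw [injective_iff_map_eq_one]
  rintro ⟨g, e⟩ h
  have h1 : rep Γ g * permRep Γ e = 1 := h
  have hg : g = 1 := by
    refine eq_one_of_rep_one ?_
    -- `permRep Γ e` fixes the constant vector, so `rep Γ g` must fix it as well.
    have := congrArg (fun T => T (1 : V × Bool → ℤ)) h1
    exact this
  subst hg
  rw [map_one, one_mul] at h1
  have he : e = 1 := by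
    classical
    ext v
    have := congrFun (congrArg (fun T => T (Pi.single (v, true) 1)) h1) (e v, true)
    by_contra hne
    simp [permRep_apply, show e v ≠ v from hne] at this
  subst he
  rfl

end RAAG

/-! ### Linearity over the integers -/

lemma IsZLinear.of_injective {G H : Type*} [Group G] [Group H] (hH : IsZLinear H) (φ : G →* H)
    (hφ : Function.Injective φ) : IsZLinear G := by
  obtain ⟨d, ρ, hρ⟩ := hH
  exact ⟨d, ρ.comp φ, hρ.comp hφ⟩

lemma isZLinear_linearEquiv (M : Type*) [AddCommGroup M] [Module.Free ℤ M] [Module.Finite ℤ M] :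
    IsZLinear (M ≃ₗ[ℤ] M) := by
  let E : (M →ₗ[ℤ] M) ≃* Matrix (Fin (Module.finrank ℤ M)) (Fin (Module.finrank ℤ M)) ℤ :=
    (LinearMap.toMatrixAlgEquiv (Module.finBasis ℤ M) : _ ≃ₐ[ℤ] _)
  refine ⟨Module.finrank ℤ M, ((Units.mapEquiv E).toMonoidHom.comp
    (LinearMap.GeneralLinearGroup.generalLinearEquiv ℤ M).symm.toMonoidHom), ?_⟩
  exact (Units.mapEquiv E).injective.comp
    (LinearMap.GeneralLinearGroup.generalLinearEquiv ℤ M).symm.injective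

/-- The semidirect product of a right-angled Artin group of finite rank with the group of
automorphisms of its graph is linear over `ℤ`. -/
theorem RAAG.isZLinear_semidirectProduct {V : Type*} [Finite V] (Γ : SimpleGraph V) :
    IsZLinear (RAAG Γ ⋊[autHom Γ] (Γ ≃g Γ)) :=
  (isZLinear_linearEquiv _).of_injective _ (semidirectRep_injective Γ)

/-- Two groups with a common subgroup embed compatibly in a third one. -/
lemma exists_amalgam {K G H : Type u} [Group K] [Group G] [Group H] (φ : K →* G) (ψ : K →* H)
    (hφ : Function.Injective φ) (hψ : Function.Injective ψ) :
    ∃ (P : Type u) (_ : Group P) (j₁ : G →* P) (j₂ : H →* P),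
      Function.Injective j₁ ∧ ∀ k, j₁ (φ k) = j₂ (ψ k) := by
  have key (F : Bool → Type u) [∀ b, Group (F b)] (θ : ∀ b, K →* F b)
      (hθ : ∀ b, Function.Injective (θ b)) :
      ∃ (P : Type u) (_ : Group P) (j₁ : F true →* P) (j₂ : F false →* P),
        Function.Injective j₁ ∧ ∀ k, j₁ (θ true k) = j₂ (θ false k) :=
    ⟨Monoid.PushoutI θ, inferInstance, Monoid.PushoutI.of true, Monoid.PushoutI.of false,
      Monoid.PushoutI.of_injective hθ true, fun k =>
        (Monoid.PushoutI.of_apply_eq_base θ true k).trans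
          (Monoid.PushoutI.of_apply_eq_base θ false k).symm⟩
  exact @key (fun b => Bool.rec H G b) (fun | true => ‹Group G› | false => ‹Group H›)
    (fun | true => φ | false => ψ) (fun | true => hφ | false => hψ)

/-! ### Multiple HNN-extensions and their base group -/

namespace MultipleHNN

variable {V : Type*} (Γ : SimpleGraph V) {n : ℕ} (A B : Fin n → Set V) (f : ∀ i, A i ≃ B i)

/-- The vertex generators of a multiple HNN-extension. -/
def base : RAAG Γ →* MultipleHNN Γ A B f :=
  RAAG.lift Γ (fun v => PresentedGroup.of (Sum.inl v)) fun v w h => by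
    have h1 : (PresentedGroup.of (Sum.inl v) * PresentedGroup.of (Sum.inl w) *
        (PresentedGroup.of (Sum.inl v))⁻¹ * (PresentedGroup.of (Sum.inl w))⁻¹ :
        MultipleHNN Γ A B f) = 1 :=
      PresentedGroup.one_of_mem (rels := rels Γ A B f) (Or.inl ⟨v, w, h, rfl⟩)
    rw [mul_inv_eq_one, mul_inv_eq_iff_eq_mul] at h1
    exact h1

lemma base_gen (v : V) :
    base Γ A B f (RAAG.gen Γ v) = PresentedGroup.of (Sum.inl v) :=
  RAAG.lift_gen _ _ _ _

/-- The stable letters. -/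
def stable (i : Fin n) : MultipleHNN Γ A B f := PresentedGroup.of (Sum.inr i)

lemma stable_mul (i : Fin n) (a : A i) :
    stable Γ A B f i * base Γ A B f (RAAG.gen Γ a) * (stable Γ A B f i)⁻¹ =
      base Γ A B f (RAAG.gen Γ (f i a)) := by
  have h1 : (PresentedGroup.of (Sum.inr i) * PresentedGroup.of (Sum.inl (a : V)) *
      (PresentedGroup.of (Sum.inr i))⁻¹ * (PresentedGroup.of (Sum.inl (f i a : V)))⁻¹ :
      MultipleHNN Γ A B f) = 1 :=
    PresentedGroup.one_of_mem (rels := rels Γ A B f) (Or.inr ⟨i, a, rfl⟩)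
  rw [mul_inv_eq_one] at h1
  simpa only [base_gen, stable] using h1

/-- The universal property of a multiple HNN-extension. -/
def lift {H : Type*} [Group H] (φ : RAAG Γ →* H) (t : Fin n → H)
    (ht : ∀ i (a : A i), t i * φ (RAAG.gen Γ a) * (t i)⁻¹ = φ (RAAG.gen Γ (f i a))) :
    MultipleHNN Γ A B f →* H :=
  PresentedGroup.toGroup (f := Sum.elim (fun v => φ (RAAG.gen Γ v)) t) <| by
    rintro r (⟨v, w, h, rfl⟩ | ⟨i, a, rfl⟩)
    · simp [((RAAG.gen_commute Γ h).map φ).eq]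
    · simp [ht]

section

variable {H : Type*} [Group H] (φ : RAAG Γ →* H) (t : Fin n → H)
  (ht : ∀ i (a : A i), t i * φ (RAAG.gen Γ a) * (t i)⁻¹ = φ (RAAG.gen Γ (f i a)))

@[simp]
lemma lift_base (g : RAAG Γ) : lift Γ A B f φ t ht (base Γ A B f g) = φ g := by
  suffices (lift Γ A B f φ t ht).comp (base Γ A B f) = φ from DFunLike.congr_fun this g
  refine RAAG.hom_ext fun v => ?_
  simp only [MonoidHom.comp_apply, base_gen]
  exact PresentedGroup.toGroup.of _

@[simp]
lemma lift_stable (i : Fin n) : lift Γ A B f φ t ht (stable Γ A B f i) = t i :=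
  PresentedGroup.toGroup.of _

end

variable {Γ A B f} in
lemma hom_ext {H : Type*} [Group H] {φ ψ : MultipleHNN Γ A B f →* H}
    (h : ∀ v, φ (base Γ A B f (RAAG.gen Γ v)) = ψ (base Γ A B f (RAAG.gen Γ v)))
    (ht : ∀ i, φ (stable Γ A B f i) = ψ (stable Γ A B f i)) : φ = ψ := by
  refine PresentedGroup.ext ?_
  rintro (v | i)
  · simpa only [base_gen] using h v
  · exact ht i

/-- If the partial maps are restrictions of graph automorphisms, the base group embeds. -/
lemma base_injective (e : Fin n → (Γ ≃g Γ)) (he : ∀ i (a : A i), e i a = f i a) :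
    Function.Injective (base Γ A B f) := by
  -- Sending `t i` to `e i` itself respects the relators and restricts to the canonical inclusion on
  -- the base.
  let r : MultipleHNN Γ A B f →* RAAG Γ ⋊[RAAG.autHom Γ] (Γ ≃g Γ) :=
    lift Γ A B f SemidirectProduct.inl (fun i => SemidirectProduct.inr (e i)) fun i a => by
      rw [← map_inv, ← SemidirectProduct.inl_aut, RAAG.autHom_gen, he]
  refine Function.Injective.of_comp (f := r) ?_
  have : r ∘ base Γ A B f = SemidirectProduct.inl := funext fun g => lift_base _ _ _ _ _ _ _ _
  rw [this]
  exact SemidirectProduct.inl_injective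

/-! ### Embedding into an extended right-angled Artin group -/

/-- The graph `Γ` with new vertices `(i, d)`, where `d` runs through the automorphisms of `Γ`;
the vertex `(i, d)` is joined to the translate `d (B i)`. -/
def extGraph : SimpleGraph (V ⊕ Fin n × (Γ ≃g Γ)) where
  Adj
    | .inl v, .inl w => Γ.Adj v w
    | .inl v, .inr (i, d) => d⁻¹ v ∈ B i
    | .inr (i, d), .inl v => d⁻¹ v ∈ B i
    | .inr _, .inr _ => False
  symm := ⟨by
    rintro (v | ⟨i, d⟩) (w | ⟨j, e⟩) h
    · exact h.symm
    · exact h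
    · exact h
    · exact h⟩
  loopless := ⟨by
    rintro (v | ⟨i, d⟩) h
    · exact Γ.loopless.irrefl v h
    · exact h⟩

/-- Automorphisms of `Γ` act on the extended graph. -/
def extHom : (Γ ≃g Γ) →* (extGraph Γ B ≃g extGraph Γ B) where
  toFun e :=
    { toEquiv := e.toEquiv.sumCongr ((Equiv.refl _).prodCongr (Equiv.mulLeft e))
      map_rel_iff' := by
        rintro (v | ⟨i, d⟩) (w | ⟨j, d'⟩)
        · exact e.map_rel_iff
        · simp [extGraph]
        · simp [extGraph]
        · simp [extGraph] }
  map_one' := by ext (v | ⟨i, d⟩) <;> simp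
  map_mul' d e := by ext (v | ⟨i, d⟩) <;> simp [mul_assoc]

@[simp]
lemma extHom_inl (e : Γ ≃g Γ) (v : V) : extHom Γ B e (Sum.inl v) = Sum.inl (e v) := rfl

@[simp]
lemma extHom_inr (e d : Γ ≃g Γ) (i : Fin n) :
    extHom Γ B e (Sum.inr (i, d)) = Sum.inr (i, e * d) := rfl

lemma extHom_injective : Function.Injective (extHom Γ B) := by
  intro d e h
  ext v
  exact Sum.inl_injective (DFunLike.congr_fun h (Sum.inl v))

/-- The inclusion of right-angled Artin groups induced by `Γ ⊆ extGraph Γ B`. -/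
def extIncl : RAAG Γ →* RAAG (extGraph Γ B) :=
  RAAG.lift Γ (fun v => RAAG.gen _ (Sum.inl v)) fun _ _ h =>
    RAAG.gen_commute (extGraph Γ B) h

@[simp]
lemma extIncl_gen (v : V) : extIncl Γ B (RAAG.gen Γ v) = RAAG.gen _ (Sum.inl v) :=
  RAAG.lift_gen _ _ _ _

/-- The right-angled Artin group of the extended graph, extended by the automorphisms of `Γ`. -/
abbrev Ext : Type _ :=
  RAAG (extGraph Γ B) ⋊[(RAAG.autHom (extGraph Γ B)).comp (extHom Γ B)] (Γ ≃g Γ)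

/-- The homomorphism sending the stable letter `t i` to `(i, 1) * e i`. -/
def toExt (e : Fin n → (Γ ≃g Γ)) (he : ∀ i (a : A i), e i a = f i a) :
    MultipleHNN Γ A B f →* Ext Γ B :=
  lift Γ A B f (SemidirectProduct.inl.comp (extIncl Γ B))
    (fun i => SemidirectProduct.inl (RAAG.gen _ (Sum.inr (i, 1))) * SemidirectProduct.inr (e i))
    fun i a => by
      have hc : Commute (RAAG.gen (extGraph Γ B) (Sum.inr (i, 1)))
          (RAAG.gen (extGraph Γ B) (Sum.inl (f i a : V))) :=
        RAAG.gen_commute (extGraph Γ B) (f i a).2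
      have h1 := SemidirectProduct.inl_aut
        (φ := (RAAG.autHom (extGraph Γ B)).comp (extHom Γ B)) (e i)
        (RAAG.gen (extGraph Γ B) (Sum.inl (a : V)))
      simp only [MonoidHom.comp_apply, RAAG.autHom_gen, extHom_inl, he] at h1
      simp only [MonoidHom.comp_apply, extIncl_gen, mul_inv_rev, ← map_inv]
      rw [← mul_assoc, mul_assoc (SemidirectProduct.inl _), mul_assoc (SemidirectProduct.inl _)]
      rw [← h1, ← map_mul, ← map_mul, hc.eq, mul_inv_cancel_right]

/-- It suffices to factor an injective map of the HNN-extension through `toExt`; the inclusion `j₁`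
into the amalgam with `RAAG Γ ⋊ Aut Γ` is such a map. -/
lemma toExt_injective (e : Fin n → (Γ ≃g Γ)) (he : ∀ i (a : A i), e i a = f i a) :
    Function.Injective (toExt Γ A B f e he) := by
  obtain ⟨P, _, j₁, j₂, hj, hcomp⟩ := exists_amalgam (base Γ A B f)
    (SemidirectProduct.inl : RAAG Γ →* RAAG Γ ⋊[RAAG.autHom Γ] (Γ ≃g Γ))
    (base_injective Γ A B f e he) SemidirectProduct.inl_injective
  let u : (Γ ≃g Γ) →* P := j₂.comp SemidirectProduct.inr
  let x : V → P := fun v => j₁ (base Γ A B f (RAAG.gen Γ v))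
  let t : Fin n → P := fun i => j₁ (stable Γ A B f i)
  have hux : ∀ d v, u d * x v * (u d)⁻¹ = x (d v) := by
    intro d v
    simp only [u, x, hcomp, MonoidHom.comp_apply]
    rw [← RAAG.autHom_gen, SemidirectProduct.inl_aut, map_mul, map_mul, map_inv, map_inv]
  have hux' : ∀ d v, u d * x v = x (d v) * u d := fun d v => mul_inv_eq_iff_eq_mul.1 (hux d v)
  have htx : ∀ i (a : A i), t i * x a = x (f i a) * t i := by
    intro i a
    rw [← mul_inv_eq_iff_eq_mul]
    simp only [t, x, ← map_mul, ← map_inv, stable_mul]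
  -- The image of `(i, 1)` is forced to be `t i * (u (e i))⁻¹`, and equivariance forces its
  -- conjugate by `u d` at `(i, d)`.
  let s : Fin n × (Γ ≃g Γ) → P := fun k => u k.2 * (t k.1 * (u (e k.1))⁻¹) * (u k.2)⁻¹
  have hsx : ∀ i d v, d⁻¹ v ∈ B i → Commute (s (i, d)) (x v) := by
    intro i d v hv
    obtain ⟨a, ha⟩ := (f i).surjective ⟨_, hv⟩
    have hv' : v = d (e i a) := by
      rw [he, ha]
      simp
    have h0 : (u (e i))⁻¹ * x (e i a) = x a * (u (e i))⁻¹ := by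
      rw [inv_mul_eq_iff_eq_mul, ← mul_assoc, eq_mul_inv_iff_mul_eq, hux']
    have h1 : Commute (t i * (u (e i))⁻¹) (x (e i a)) := by
      rw [Commute, SemiconjBy, mul_assoc, h0, ← mul_assoc, htx, he, mul_assoc]
    have h2 := h1.map (MulAut.conj (u d)).toMonoidHom
    simp only [MulEquiv.coe_toMonoidHom, MulAut.conj_apply, hux] at h2
    rw [hv']
    exact h2
  let Φ : RAAG (extGraph Γ B) →* P := RAAG.lift _ (Sum.elim x s) (by
    rintro (v | ⟨i, d⟩) (w | ⟨j, d'⟩) h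
    · exact ((RAAG.gen_commute Γ h).map (base Γ A B f)).map j₁
    · exact (hsx _ _ _ h).symm
    · exact hsx _ _ _ h
    · exact h.elim)
  let Ψ : Ext Γ B →* P := SemidirectProduct.lift Φ u fun d => RAAG.hom_ext (by
    rintro (v | ⟨i, d'⟩)
    · simp [Φ, hux]
    · simp [Φ, s, mul_assoc])
  have hΨ : Ψ.comp (toExt Γ A B f e he) = j₁ := by
    refine hom_ext (fun v => ?_) fun i => ?_
    · simp [toExt, Ψ, Φ, x]
    · simp [toExt, Ψ, Φ, s, t]
  refine Function.Injective.of_comp (f := Ψ) ?_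
  rw [← MonoidHom.coe_comp, hΨ]
  exact hj

/-- The multiple HNN-extension of a right-angled Artin group of finite rank along restrictions of
graph automorphisms is linear over `ℤ`. -/
theorem isZLinear [Finite V] (e : Fin n → (Γ ≃g Γ)) (he : ∀ i (a : A i), e i a = f i a) :
    IsZLinear (MultipleHNN Γ A B f) := by
  -- This keeps the vertex set of the extended graph finite, hence the representation
  -- finite-dimensional.
  have : Finite (Γ ≃g Γ) := DFunLike.finite _
  let ι : Ext Γ B →* RAAG (extGraph Γ B) ⋊[RAAG.autHom _] (extGraph Γ B ≃g extGraph Γ B) :=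
    SemidirectProduct.map (MonoidHom.id _) (extHom Γ B) fun _ => rfl
  have hι : Function.Injective ι := by
    intro a b h
    exact SemidirectProduct.ext (congrArg (fun y => y.left) h)
      (extHom_injective Γ B (congrArg (fun y => y.right) h))
  exact (RAAG.isZLinear_semidirectProduct (extGraph Γ B)).of_injective
    (ι.comp (toExt Γ A B f e he)) (hι.comp (toExt_injective Γ A B f e he))

end MultipleHNN

/-! ### From automorphisms of the group to automorphisms of the graph -/

/-- A permutation of the vertices which induces an automorphism of the right-angled Artin group is
an automorphism of the graph. -/
lemma RAAG.adj_iff_of_mulAut {V : Type*} (Γ : SimpleGraph V) (φ : MulAut (RAAG Γ))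
    (σ : Equiv.Perm V) (h : ∀ v, φ (gen Γ v) = gen Γ (σ v)) (v w : V) :
    Γ.Adj (σ v) (σ w) ↔ Γ.Adj v w := by
  constructor
  · intro hadj
    refine adj_of_commute Γ (fun e => hadj.ne (congrArg σ e)) ?_
    have := gen_commute Γ hadj
    rw [← h, ← h] at this
    simpa using this.map φ.symm.toMonoidHom
  · intro hadj
    refine adj_of_commute Γ (σ.injective.ne hadj.ne) ?_
    rw [← h, ← h]
    exact (gen_commute Γ hadj).map φ.toMonoidHom

theorem mainTheorem8 {V : Type*} [Finite V] (Γ : SimpleGraph V) (n : ℕ)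
    (A B : Fin n → Set V) (f : ∀ i, A i ≃ B i)
    (fbar : Fin n → MulAut (RAAG Γ)) (σ : Fin n → Equiv.Perm V)
    (hσ : ∀ i v, fbar i (RAAG.gen Γ v) = RAAG.gen Γ (σ i v))
    (hext : ∀ i (a : A i), fbar i (RAAG.gen Γ a) = RAAG.gen Γ (f i a))
    (hcycle : ∀ i v, IsFreeAbelian
      (Subgroup.closure (RAAG.gen Γ '' {w | (σ i).SameCycle v w})))
    (hfin : Finite (Subgroup.closure (Set.range fbar))) :
    IsZLinear (MultipleHNN Γ A B f) := by
  exact MultipleHNN.isZLinear Γ A B f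
    (fun i => ⟨σ i, fun {v w} => RAAG.adj_iff_of_mulAut Γ (fbar i) (σ i) (hσ i) v w⟩)
    fun i a => RAAG.gen_injective Γ ((hσ i a).symm.trans (hext i a))
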